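/- Let $C\subset\mathbb{R}^n$ be a closed convex set with nonempty interior, and let $h\colon\mathbb{R}^n\to\,]-\infty,+\infty]$ be a proper, lower-semicontinuous, convex function such that $C\subset\operatorname{int}(\operatorname{dom} h)$ and $h$ is continuously differentiable on $C$. Let $A$ be a monotone, continuous (single-valued) operator defined on $C$, so that $\operatorname{dom}A=C$. Consider the problem $$\text{find } \widehat x\in\mathbb{R}^n \text{ such that } 0\in A(\widehat x)+\partial h(\widehat x)+N_C(\widehat x),\qquad(\ast)$$ where $\partial h$ is the Moreau subdifferential of $h$, and $N_C(x)=\{u\mid \langle y-x,u\rangle\le 0 \text{ for all } y\in C\}$ if $x\in C$ and $N_C(x)=\varnothing$ otherwise. Assume that $(\ast)$ has a solution. Let $x_0\in C$, let $(\gamma_k)_{k\in\mathbb{N}}$ be a sequence in $]0,+\infty[$, and let $(x_k)_{k\in\mathbb{N}}$ be generated by the projected forward-backward-forward iteration: for every $k\in\mathbb{N}$, $$a_k=A(x_k)+\nabla h(x_k),\qquad z_k=\operatorname{proj}_C(x_k-\gamma_k a_k),\qquad x_{k+1}=\operatorname{proj}_C\bigl(z_k-\gamma_k(A(z_k)+\nabla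 h(z_k)-a_k)\bigr).$$ Assume that the step sizes satisfy the Armijo--Goldstein rule for $B=A+\nabla h$ and $f=\iota_C$ (the indicator function of $C$, equal to $0$ on $C$ and to $+\infty$ elsewhere): there are constants $\sigma\in\,]0,+\infty[$ and $\beta,\theta\in\,]0,1[$ such that, for every $k\in\mathbb{N}$, $\gamma_k=\sigma\beta^{i_k}$, where $i_k$ is the smallest $i\in\mathbb{N}$ such that, with $\gamma=\sigma\beta^i$ and $z=\operatorname{prox}_{\gamma f}(x_k-\gamma B(x_k))$, $$\gamma\,\|B(z)-B(x_k)\|\le\theta\,\|z-x_k\|.$$ Here $\operatorname{prox}_{\gamma f}(x)$ is the unique point $p$ such that $x-p\in\partial(\gamma f)(p)$. Then $(x_k)_{k\in\mathbb{N}}$ converges to a solution of $(\ast)$, and this solution belongs to $\operatorname{dom}A=C$. -/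

import Mathlib

namespace TsengFBF

/-- The Euclidean space `ℝⁿ` with the `ℓ²` norm. -/
abbrev Rn (n : ℕ) : Type := EuclideanSpace ℝ (Fin n)

/-! ### Set-valued operators -/

/-- The domain of a set-valued operator. -/
def operatorDomain {n : ℕ} (T : Rn n → Set (Rn n)) : Set (Rn n) :=
  {x | (T x).Nonempty}

/-- Monotonicity of a set-valued operator. -/
def IsMonotoneOperator {n : ℕ} (T : Rn n → Set (Rn n)) : Prop :=
  ∀ x y : Rn n, ∀ u ∈ T x, ∀ v ∈ T y, 0 ≤ inner ℝ (u - v) (x - y)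

/-- The set-valued operator with domain `C` which is single-valued on `C`, with value `A x` at
`x ∈ C`, and which is empty-valued outside `C` (the values of `A` outside `C` are irrelevant). -/
def operatorOn {n : ℕ} (C : Set (Rn n)) (A : Rn n → Rn n) (x : Rn n) : Set (Rn n) :=
  {u | x ∈ C ∧ u = A x}

/-- The normal cone to `C` at `x`, empty when `x ∉ C`. -/
def normalCone {n : ℕ} (C : Set (Rn n)) (x : Rn n) : Set (Rn n) :=
  {u | x ∈ C ∧ ∀ y ∈ C, inner ℝ (y - x) u ≤ 0}

/-! ### Extended-real-valued convex functions -/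

/-- The effective domain of an extended-real-valued function. -/
def effectiveDomain {n : ℕ} (f : Rn n → EReal) : Set (Rn n) :=
  {x | f x < ⊤}

/-- `f` takes its values in `]-∞, +∞]` and is not identically `+∞`. -/
def IsProperFunction {n : ℕ} (f : Rn n → EReal) : Prop :=
  (∀ x, f x ≠ ⊥) ∧ (effectiveDomain f).Nonempty

/-- Convexity of an extended-real-valued function: its epigraph is convex. -/
def IsConvexFunction {n : ℕ} (f : Rn n → EReal) : Prop :=
  Convex ℝ {p : Rn n × ℝ | f p.1 ≤ (p.2 : EReal)}

/-- The Moreau subdifferential. -/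
def subdifferential {n : ℕ} (f : Rn n → EReal) (x : Rn n) : Set (Rn n) :=
  {u | ∀ y : Rn n, f x + ((inner ℝ (y - x) u : ℝ) : EReal) ≤ f y}

open Classical in
/-- The indicator function of `C`: `0` on `C` and `+∞` outside. -/
noncomputable def indicatorFun {n : ℕ} (C : Set (Rn n)) (x : Rn n) : EReal :=
  if x ∈ C then 0 else ⊤

/-- The gradient of an extended-real-valued function (meaningful at the points in the interior of
the effective domain where the function is differentiable). -/
noncomputable def grad {n : ℕ} (f : Rn n → EReal) (x : Rn n) : Rn n :=
  gradient (fun y => (f y).toReal) x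

/-- `f` is continuously differentiable on `C` (used for `C` contained in the interior of the
effective domain of `f`): it is differentiable at each point of `C`, and its gradient is
continuous on `C`. -/
def IsContDiffOn {n : ℕ} (f : Rn n → EReal) (C : Set (Rn n)) : Prop :=
  (∀ x ∈ C, DifferentiableAt ℝ (fun y => (f y).toReal) x) ∧ ContinuousOn (grad f) C

/-- `p` is the value at `x` of the proximity operator of `f`, i.e. `x - p ∈ ∂f(p)`. -/
def IsProx {n : ℕ} (f : Rn n → EReal) (x p : Rn n) : Prop :=
  x - p ∈ subdifferential f p

/-- `p` is the projection of `x` onto `C`, i.e. a point of `C` nearest to `x`. -/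
def IsProj {n : ℕ} (C : Set (Rn n)) (x p : Rn n) : Prop :=
  p ∈ C ∧ ∀ y ∈ C, ‖x - p‖ ≤ ‖x - y‖

/-! ### The inclusion, the algorithm and the step-size rule -/

open scoped Pointwise in
/-- `x` solves the inclusion `0 ∈ A(x) + ∂h(x) + N_C(x)`, where `A` is an operator defined
on `C`. -/
def IsSolution {n : ℕ} (C : Set (Rn n)) (h : Rn n → EReal) (A : Rn n → Rn n) (x : Rn n) : Prop :=
  (0 : Rn n) ∈ operatorOn C A x + subdifferential h x + normalCone C x

/-- `(x_k)` is generated by the projected forward-backward-forward iteration with step sizes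
`(γ_k)`, where `z_k` are the intermediate points. -/
structure IsFBFSequence {n : ℕ} (C : Set (Rn n)) (h : Rn n → EReal) (A : Rn n → Rn n)
    (γ : ℕ → ℝ) (x z : ℕ → Rn n) : Prop where
  init_mem : x 0 ∈ C
  step_pos : ∀ k, 0 < γ k
  forward_backward : ∀ k, IsProj C (x k - γ k • (A (x k) + grad h (x k))) (z k)
  forward : ∀ k, IsProj C
    (z k - γ k • (A (z k) + grad h (z k) - (A (x k) + grad h (x k)))) (x (k + 1))

/-- The indices `i` that pass the Armijo-Goldstein test at the point `x`: with `γ = σ βⁱ` and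
`z = prox_{γ f} (x - γ B x)`, one has `γ ‖B z - B x‖ ≤ θ ‖z - x‖`. -/
def armijoIndices {n : ℕ} (B : Rn n → Rn n) (f : Rn n → EReal) (σ β θ : ℝ) (x : Rn n) : Set ℕ :=
  {i | ∃ γ : ℝ, γ = σ * β ^ i ∧ ∃ z : Rn n,
    IsProx (fun y => (γ : EReal) * f y) (x - γ • B x) z ∧ γ * ‖B z - B x‖ ≤ θ * ‖z - x‖}

/-- The Armijo-Goldstein rule with parameters `σ, β, θ`: at each iteration `γ_k = σ β^{i_k}`, where
`i_k` is the smallest index that passes the test at `x_k`. -/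
def ArmijoGoldstein {n : ℕ} (B : Rn n → Rn n) (f : Rn n → EReal) (σ β θ : ℝ)
    (x : ℕ → Rn n) (γ : ℕ → ℝ) : Prop :=
  ∀ k, ∃ i : ℕ, IsLeast (armijoIndices B f σ β θ (x k)) i ∧ γ k = σ * β ^ i

end TsengFBF

namespace TsengFBF

open Filter Topology

/-! ### Projections onto convex sets -/

section Projection

variable {n : ℕ} {C : Set (Rn n)}

/-! On `C` the inclusion amounts to the variational inequality `⟨B s, y - s⟩ ≥ 0` for all `y ∈ C`,
with `B = A + ∇h` monotone and continuous (`isSolution_iff`). By `fbf_step_le`, the distance from `x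
k` to each solution never increases and `z k - x k → 0`; hence the iterates are bounded and have a
cluster point.

The difficulty is to show that a cluster point is a solution: `B` is only continuous, so the steps
`γ k` may tend to `0` and `(x k - z k) / γ k` is not controlled. `exists_normal_of_isLeast` uses the
last rejected trial step `γ k / β` instead: its point `w` stays close to `x k`, and failure of the
test bounds the scaled residual by `‖B w - B (x k)‖ / θ`, which vanishes along the subsequence by
continuity. Monotonicity of the distance to this solution then gives convergence of the whole
sequence. -/

theorem IsProj.inner_le_zero (hC : Convex ℝ C) {x p : Rn n} (hp : IsProj C x p) :
    ∀ y ∈ C, inner ℝ (x - p) (y - p) ≤ 0 := by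
  have : Nonempty C := ⟨⟨p, hp.1⟩⟩
  refine (norm_eq_iInf_iff_real_inner_le_zero hC hp.1).1 (le_antisymm ?_ ?_)
  · exact le_ciInf fun w => hp.2 w w.2
  · exact ciInf_le ⟨0, by rintro _ ⟨w, rfl⟩; exact norm_nonneg _⟩ (⟨p, hp.1⟩ : C)

theorem exists_projection (hne : C.Nonempty) (hcl : IsClosed C) (hC : Convex ℝ C) (x : Rn n) :
    ∃ p ∈ C, ∀ y ∈ C, inner ℝ (x - p) (y - p) ≤ 0 := by
  obtain ⟨p, hp, h⟩ := exists_norm_eq_iInf_of_complete_convex hne hcl.isComplete hC x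
  exact ⟨p, hp, (norm_eq_iInf_iff_real_inner_le_zero hC hp).1 h⟩

/-- A projection onto `C`, in its variational form, is unique. -/
theorem projection_unique {x p q : Rn n} (hp : p ∈ C) (hq : q ∈ C)
    (hp' : ∀ y ∈ C, inner ℝ (x - p) (y - p) ≤ 0) (hq' : ∀ y ∈ C, inner ℝ (x - q) (y - q) ≤ 0) :
    p = q := by
  have h1 := hp' q hq
  have h2 := hq' p hp
  have h3 : inner ℝ (p - q) (p - q) = inner ℝ (x - p) (q - p) + inner ℝ (x - q) (p - q) := by
    simp only [inner_sub_left, inner_sub_right]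
    ring
  rw [real_inner_self_eq_norm_sq] at h3
  exact sub_eq_zero.1 (norm_eq_zero.1 (by nlinarith [norm_nonneg (p - q)]))

/-- Projections do not increase the distance to the points of `C`. -/
theorem norm_sub_le_of_projection {x p y : Rn n} (hp : ∀ y ∈ C, inner ℝ (x - p) (y - p) ≤ 0)
    (hy : y ∈ C) : ‖p - y‖ ≤ ‖x - y‖ := by
  have h1 := hp y hy
  have h2 : ‖x - y‖ ^ 2 = ‖x - p‖ ^ 2 + ‖p - y‖ ^ 2 - 2 * inner ℝ (x - p) (y - p) := by
    have : x - y = (x - p) - (y - p) := by abel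
    rw [this, norm_sub_sq_real, norm_sub_rev p y]
    ring
  exact le_of_sq_le_sq (by nlinarith [sq_nonneg ‖x - p‖]) (norm_nonneg _)

/-- The residual `‖x - proj_C (x - γ a)‖ / γ` does not increase with `γ`. -/
theorem residual_le {x a p q : Rn n} {γ γ' : ℝ} (hγ : 0 < γ) (hγ' : γ ≤ γ')
    (hp : p ∈ C) (hq : q ∈ C)
    (hp' : ∀ y ∈ C, inner ℝ (x - γ • a - p) (y - p) ≤ 0)
    (hq' : ∀ y ∈ C, inner ℝ (x - γ' • a - q) (y - q) ≤ 0) :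
    γ * ‖x - q‖ ≤ γ' * ‖x - p‖ := by
  have h1 := hp' q hq
  have h2 := hq' p hp
  obtain ⟨u, rfl⟩ : ∃ u, p = x - u := ⟨x - p, by abel⟩
  obtain ⟨v, rfl⟩ : ∃ v, q = x - v := ⟨x - q, by abel⟩
  have e1 : inner ℝ (x - γ • a - (x - u)) (x - v - (x - u))
      = ‖u‖ ^ 2 - inner ℝ u v - γ * inner ℝ a (u - v) := by
    rw [show x - γ • a - (x - u) = u - γ • a by abel, show x - v - (x - u) = u - v by abel,
      inner_sub_left, real_inner_smul_left, inner_sub_right u, real_inner_self_eq_norm_sq]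
  have e2 : inner ℝ (x - γ' • a - (x - v)) (x - u - (x - v))
      = ‖v‖ ^ 2 - inner ℝ u v + γ' * inner ℝ a (u - v) := by
    rw [show x - γ' • a - (x - v) = v - γ' • a by abel, show x - u - (x - v) = v - u by abel,
      inner_sub_left, real_inner_smul_left, inner_sub_right v, real_inner_self_eq_norm_sq,
      real_inner_comm u v, ← neg_sub u v, inner_neg_right]
    ring
  rw [e1] at h1
  rw [e2] at h2
  have h3 := real_inner_le_norm u v
  have hpos : 0 < γ' := hγ.trans_le hγ'
  rw [sub_sub_cancel, sub_sub_cancel]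
  -- In `γ' * h1 + γ * h2` the terms in `a` cancel; Cauchy-Schwarz then lets the left side factor.
  have h4 : (γ' * ‖u‖ - γ * ‖v‖) * (‖u‖ - ‖v‖) ≤ 0 := by
    nlinarith [mul_le_mul_of_nonneg_left h1 hpos.le, mul_le_mul_of_nonneg_left h2 hγ.le,
      mul_le_mul_of_nonneg_left h3 (add_pos hγ hpos).le]
  by_contra! hlt
  rcases le_or_gt ‖v‖ ‖u‖ with hle | hgt
  · nlinarith [mul_le_mul hγ' hle (norm_nonneg _) hpos.le]
  · nlinarith

/-- Nonemptiness matters: for empty `C` the function is constantly `⊤` and every `p` satisfies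
`IsProx`. -/
theorem isProx_smul_indicatorFun_iff {γ : ℝ} (hγ : 0 < γ) (hne : C.Nonempty) {x p : Rn n} :
    IsProx (fun y => (γ : EReal) * indicatorFun C y) x p ↔
      p ∈ C ∧ ∀ y ∈ C, inner ℝ (x - p) (y - p) ≤ 0 := by
  have hin : ∀ y ∈ C, (γ : EReal) * indicatorFun C y = 0 := fun y hy => by
    simp [indicatorFun, hy]
  have hout : ∀ y ∉ C, (γ : EReal) * indicatorFun C y = ⊤ := fun y hy => by
    simp [indicatorFun, hy, EReal.coe_mul_top_of_pos hγ]
  constructor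
  · intro h
    have hp : p ∈ C := by
      by_contra hp
      obtain ⟨y, hy⟩ := hne
      have := h y
      simp only [hin y hy, hout p hp, EReal.top_add_coe] at this
      exact absurd this (by simp)
    refine ⟨hp, fun y hy => ?_⟩
    have := h y
    simp only [hin y hy, hin p hp, zero_add] at this
    rw [real_inner_comm]
    exact_mod_cast this
  · rintro ⟨hp, h⟩ y
    by_cases hy : y ∈ C
    · simp only [hin y hy, hin p hp, zero_add]
      rw [real_inner_comm]
      exact_mod_cast h y hy
    · simp only [hout y hy, le_top]

end Projection

/-! ### Convex functions and their gradients -/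

section Gradient

variable {n : ℕ} {h : Rn n → EReal}

theorem IsConvexFunction.convexOn (h_proper : IsProperFunction h) (h_convex : IsConvexFunction h) :
    ConvexOn ℝ (effectiveDomain h) (fun y => (h y).toReal) := by
  have hco : ∀ y ∈ effectiveDomain h, ((h y).toReal : EReal) = h y := fun y hy =>
    EReal.coe_toReal (ne_of_lt hy) (h_proper.1 y)
  have key : ∀ ⦃x⦄, x ∈ effectiveDomain h → ∀ ⦃y⦄, y ∈ effectiveDomain h → ∀ ⦃a b : ℝ⦄,
      0 ≤ a → 0 ≤ b → a + b = 1 →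
      h (a • x + b • y) ≤ ((a * (h x).toReal + b * (h y).toReal : ℝ) : EReal) := by
    intro x hx y hy a b ha hb hab
    exact h_convex (x := (x, (h x).toReal)) (hco x hx).ge (y := (y, (h y).toReal)) (hco y hy).ge
      ha hb hab
  have hconv : Convex ℝ (effectiveDomain h) := fun x hx y hy a b ha hb hab =>
    (key hx hy ha hb hab).trans_lt (EReal.coe_lt_top _)
  refine ⟨hconv, fun x hx y hy a b ha hb hab => ?_⟩
  have := key hx hy ha hb hab
  rw [← hco _ (hconv hx hy ha hb hab)] at this
  exact_mod_cast this

/-- On the segment from `x` to `y`, a convex function of one variable has derivative at `0` at most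
its slope over `[0, 1]`. -/
theorem inner_gradient_le_sub {E : Type*} [NormedAddCommGroup E] [InnerProductSpace ℝ E]
    [CompleteSpace E] {D : Set E} {g : E → ℝ} (hg : ConvexOn ℝ D g) {x y : E} (hx : x ∈ D)
    (hy : y ∈ D) (hd : DifferentiableAt ℝ g x) :
    inner ℝ (gradient g x) (y - x) ≤ g y - g x := by
  have hc := hg.comp_affineMap (AffineMap.lineMap x y : ℝ →ᵃ[ℝ] E)
  have hder : HasDerivAt (g ∘ (AffineMap.lineMap x y : ℝ →ᵃ[ℝ] E))
      (inner ℝ (gradient g x) (y - x)) 0 := by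
    have h1 : HasFDerivAt g (InnerProductSpace.toDual ℝ E (gradient g x))
        ((AffineMap.lineMap x y : ℝ →ᵃ[ℝ] E) 0) := by
      simpa using hd.hasGradientAt.hasFDerivAt
    simpa using h1.comp_hasDerivAt (0 : ℝ) AffineMap.hasDerivAt_lineMap
  have := hc.le_slope_of_hasDerivAt (x := 0) (y := 1) (by simpa using hx) (by simpa using hy)
    one_pos hder
  simpa [slope_def_field] using this

theorem grad_mem_subdifferential (h_proper : IsProperFunction h) (h_convex : IsConvexFunction h)
    {x : Rn n} (hx : x ∈ effectiveDomain h)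
    (hd : DifferentiableAt ℝ (fun y => (h y).toReal) x) : grad h x ∈ subdifferential h x := by
  intro y
  by_cases hy : y ∈ effectiveDomain h
  · have := inner_gradient_le_sub (h_convex.convexOn h_proper) hx hy hd
    rw [← EReal.coe_toReal (ne_of_lt hx) (h_proper.1 x),
      ← EReal.coe_toReal (ne_of_lt hy) (h_proper.1 y), real_inner_comm, ← EReal.coe_add]
    exact EReal.coe_le_coe_iff.2 (by unfold grad; linarith)
  · rw [show h y = ⊤ from not_lt_top_iff.1 hy]
    exact le_top

theorem eq_grad_of_mem_subdifferential (h_proper : IsProperFunction h)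
    {x u : Rn n} (hx : x ∈ interior (effectiveDomain h))
    (hd : DifferentiableAt ℝ (fun y => (h y).toReal) x) (hu : u ∈ subdifferential h x) :
    u = grad h x := by
  have hxD : x ∈ effectiveDomain h := interior_subset hx
  -- `toReal` sends `⊤` to `0`, so the minimum is only claimed near `x`, where `h` is finite.
  have hmin : IsLocalMin (fun y => (h y).toReal - inner ℝ u y) x := by
    filter_upwards [mem_interior_iff_mem_nhds.1 hx] with y hy
    have := hu y
    rw [← EReal.coe_toReal (ne_of_lt hxD) (h_proper.1 x),
      ← EReal.coe_toReal (ne_of_lt hy) (h_proper.1 y), real_inner_comm, ← EReal.coe_add] at this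
    have := EReal.coe_le_coe_iff.1 this
    rw [inner_sub_right] at this
    linarith
  have hder := hd.hasGradientAt.hasFDerivAt.sub (innerSL ℝ u).hasFDerivAt
  have h0 := hmin.hasFDerivAt_eq_zero hder
  have h1 := DFunLike.congr_fun h0 (grad h x - u)
  have h2 : inner ℝ (grad h x - u) (grad h x - u) = 0 := by
    rw [inner_sub_left]
    simpa [grad] using h1
  exact (sub_eq_zero.1 (inner_self_eq_zero.1 h2)).symm

theorem grad_monotone (h_proper : IsProperFunction h) (h_convex : IsConvexFunction h)
    {x y : Rn n} (hx : x ∈ effectiveDomain h) (hy : y ∈ effectiveDomain h)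
    (hdx : DifferentiableAt ℝ (fun y => (h y).toReal) x)
    (hdy : DifferentiableAt ℝ (fun y => (h y).toReal) y) :
    0 ≤ inner ℝ (grad h x - grad h y) (x - y) := by
  have h1 := inner_gradient_le_sub (h_convex.convexOn h_proper) hx hy hdx
  have h2 := inner_gradient_le_sub (h_convex.convexOn h_proper) hy hx hdy
  rw [← neg_sub x y, inner_neg_right] at h1
  unfold grad
  rw [inner_sub_left]
  linarith

/-- The inclusion is equivalent to a variational inequality. -/
theorem isSolution_iff {C : Set (Rn n)} {A : Rn n → Rn n} (h_proper : IsProperFunction h)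
    (h_convex : IsConvexFunction h) (hC_dom : C ⊆ interior (effectiveDomain h))
    (h_diff : ∀ x ∈ C, DifferentiableAt ℝ (fun y => (h y).toReal) x) {x : Rn n} :
    IsSolution C h A x ↔ x ∈ C ∧ ∀ y ∈ C, 0 ≤ inner ℝ (A x + grad h x) (y - x) := by
  constructor
  · rintro ⟨_, ⟨_, ⟨hx, rfl⟩, u, hu, rfl⟩, v, ⟨-, hv⟩, hsum⟩
    refine ⟨hx, fun y hy => ?_⟩
    rw [← eq_grad_of_mem_subdifferential h_proper (hC_dom hx) (h_diff x hx) hu]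
    have h1 := hv y hy
    rw [eq_neg_of_add_eq_zero_right hsum, inner_neg_right, real_inner_comm] at h1
    linarith
  · rintro ⟨hx, hvi⟩
    refine ⟨_, ⟨_, ⟨hx, rfl⟩, _, grad_mem_subdifferential h_proper h_convex
      (interior_subset (hC_dom hx)) (h_diff x hx), rfl⟩, -(A x + grad h x), ⟨hx, fun y hy => ?_⟩,
      add_neg_cancel _⟩
    rw [inner_neg_right, real_inner_comm]
    linarith [hvi y hy]

end Gradient

/-! ### The forward-backward-forward iteration -/

section Iteration

variable {n : ℕ} {C : Set (Rn n)} {B : Rn n → Rn n}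

/-- The basic descent inequality of the forward-backward-forward step. -/
theorem fbf_step_le (hB : ∀ x ∈ C, ∀ y ∈ C, 0 ≤ inner ℝ (B x - B y) (x - y))
    {s x z w : Rn n} {γ θ : ℝ} (hγ : 0 < γ) (hs : s ∈ C)
    (hsol : ∀ y ∈ C, 0 ≤ inner ℝ (B s) (y - s)) (hz : z ∈ C)
    (hz' : ∀ y ∈ C, inner ℝ (x - γ • B x - z) (y - z) ≤ 0)
    (hw : ∀ y ∈ C, inner ℝ (z - γ • (B z - B x) - w) (y - w) ≤ 0)
    (hθ : γ * ‖B z - B x‖ ≤ θ * ‖z - x‖) :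
    ‖w - s‖ ^ 2 ≤ ‖x - s‖ ^ 2 - (1 - θ ^ 2) * ‖z - x‖ ^ 2 := by
  have h1 := hz' s hs
  -- Monotonicity carries the inequality satisfied by `B s` over to `B z`.
  have h2 : 0 ≤ inner ℝ (B z) (z - s) := by
    have := hB z hz s hs
    rw [inner_sub_left] at this
    linarith [hsol z hz]
  have h3 : ‖w - s‖ ^ 2 ≤ ‖z - γ • (B z - B x) - s‖ ^ 2 :=
    pow_le_pow_left₀ (norm_nonneg _) (norm_sub_le_of_projection hw hs) 2
  have h4 : (γ * ‖B z - B x‖) ^ 2 ≤ (θ * ‖z - x‖) ^ 2 :=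
    pow_le_pow_left₀ (by positivity) hθ 2
  have e1 : ‖z - γ • (B z - B x) - s‖ ^ 2
      = ‖z - s‖ ^ 2 - 2 * γ * inner ℝ (B z - B x) (z - s) + (γ * ‖B z - B x‖) ^ 2 := by
    rw [show z - γ • (B z - B x) - s = (z - s) - γ • (B z - B x) by abel, norm_sub_sq_real,
      real_inner_smul_right, norm_smul, Real.norm_of_nonneg hγ.le, real_inner_comm]
    ring
  have e2 : ‖x - s‖ ^ 2 = ‖z - x‖ ^ 2 + ‖z - s‖ ^ 2 + 2 * inner ℝ (x - z) (z - s) := by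
    rw [show x - s = (x - z) + (z - s) by abel, norm_add_sq_real, norm_sub_rev x z]
    ring
  have e3 : inner ℝ (x - γ • B x - z) (s - z)
      = γ * inner ℝ (B x) (z - s) - inner ℝ (x - z) (z - s) := by
    rw [show x - γ • B x - z = (x - z) - γ • B x by abel, ← neg_sub z s, inner_neg_right,
      inner_sub_left, real_inner_smul_left]
    ring
  rw [inner_sub_left] at e1
  -- The `B x` part of the cross term in `e1` is absorbed by `h1`, the `B z` part has the right sign
  -- by `h2`, and `h4` bounds the remaining square.
  nlinarith [mul_nonneg hγ.le h2]

/-- If `i` is the least index passing the Armijo-Goldstein test at `x`, there are a point `w ∈ C`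
and a multiple `e` of `x - w` with `e - B x` normal to `C` at `w`, both controlled by the accepted
point `z`. -/
theorem exists_normal_of_isLeast (hne : C.Nonempty) (hcl : IsClosed C) (hC : Convex ℝ C)
    {σ β θ : ℝ} (hσ : 0 < σ) (hβ : β ∈ Set.Ioo (0 : ℝ) 1) (hθ : 0 < θ) {x z : Rn n} {i : ℕ}
    (hi : IsLeast (armijoIndices B (indicatorFun C) σ β θ x) i) (hz : z ∈ C)
    (hz' : ∀ y ∈ C, inner ℝ (x - (σ * β ^ i) • B x - z) (y - z) ≤ 0) :
    ∃ w ∈ C, ∃ e, (∀ y ∈ C, inner ℝ (e - B x) (y - w) ≤ 0) ∧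
      ‖x - w‖ ≤ ‖x - z‖ / β ∧ ‖e‖ ≤ ‖x - z‖ / σ + ‖B w - B x‖ / θ := by
  have key : ∀ {δ : ℝ} {w : Rn n}, 0 < δ → (∀ y ∈ C, inner ℝ (x - δ • B x - w) (y - w) ≤ 0) →
      ∀ y ∈ C, inner ℝ (δ⁻¹ • (x - w) - B x) (y - w) ≤ 0 := by
    intro δ w hδ hw y hy
    have : δ⁻¹ • (x - w) - B x = δ⁻¹ • (x - δ • B x - w) := by
      rw [sub_right_comm, smul_sub δ⁻¹ (x - w), inv_smul_smul₀ hδ.ne']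
    rw [this, real_inner_smul_left]
    exact mul_nonpos_of_nonneg_of_nonpos (inv_pos.2 hδ).le (hw y hy)
  have hβ0 := hβ.1
  cases i with
  -- No trial was rejected: the step is `σ` itself, and `w = z` works.
  | zero =>
    rw [pow_zero, mul_one] at hz'
    refine ⟨z, hz, _, key hσ hz', ?_, ?_⟩
    · exact le_div_self (norm_nonneg _) hβ0 hβ.2.le
    · rw [norm_smul, norm_inv, Real.norm_of_nonneg hσ.le, ← div_eq_inv_mul]
      exact le_add_of_nonneg_right (by positivity)
  | succ j =>
    have hδ : 0 < σ * β ^ j := by positivity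
    obtain ⟨w, hw, hw'⟩ := exists_projection hne hcl hC (x - (σ * β ^ j) • B x)
    -- By minimality of `j + 1`, the trial `j` fails the test.
    have hfail : θ * ‖w - x‖ < σ * β ^ j * ‖B w - B x‖ := by
      by_contra! hle
      exact absurd (hi.2 ⟨_, rfl, w, (isProx_smul_indicatorFun_iff hδ hne).2 ⟨hw, hw'⟩, hle⟩)
        (by simp)
    have hle : σ * β ^ (j + 1) ≤ σ * β ^ j := by
      rw [pow_succ, ← mul_assoc]
      exact mul_le_of_le_one_right hδ.le hβ.2.le
    refine ⟨w, hw, _, key hδ hw', ?_, ?_⟩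
    -- The rejected and accepted steps differ by the factor `β`, whence the constant `1 / β`.
    · have := residual_le (by positivity) hle hz hw hz' hw'
      rw [pow_succ, ← mul_assoc, mul_assoc (σ * β ^ j)] at this
      rw [le_div_iff₀' hβ0]
      exact le_of_mul_le_mul_left this hδ
    · rw [norm_smul, norm_inv, Real.norm_of_nonneg hδ.le]
      refine le_add_of_nonneg_of_le (by positivity) ?_
      rw [← div_eq_inv_mul, div_le_div_iff₀ hδ hθ, norm_sub_rev x w]
      linarith

/-- A sequence of reals with `a (k + 1) ≤ a k - b k`, where `a` and `b` are nonnegative, has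
`b → 0`. -/
theorem tendsto_zero_of_le_sub {a b : ℕ → ℝ} (ha : ∀ k, 0 ≤ a k) (hb : ∀ k, 0 ≤ b k)
    (hab : ∀ k, a (k + 1) ≤ a k - b k) : Tendsto b atTop (𝓝 0) := by
  have hanti : Antitone a := antitone_nat_of_succ_le fun k => by linarith [hab k, hb k]
  have hlim := tendsto_atTop_ciInf hanti ⟨0, by rintro _ ⟨k, rfl⟩; exact ha k⟩
  have hdiff := hlim.sub (hlim.comp (tendsto_add_atTop_nat 1))
  rw [sub_self] at hdiff
  exact squeeze_zero hb (fun k => by simpa using by linarith [hab k]) hdiff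

/-- Convergence of the projected forward-backward-forward iteration for the variational inequality
of a monotone operator which is continuous on `C`. -/
theorem fbf_tendsto (hcl : IsClosed C) (hC : Convex ℝ C)
    (hB : ∀ x ∈ C, ∀ y ∈ C, 0 ≤ inner ℝ (B x - B y) (x - y)) (hBc : ContinuousOn B C)
    (hsol : ∃ s ∈ C, ∀ y ∈ C, 0 ≤ inner ℝ (B s) (y - s))
    {γ : ℕ → ℝ} {x z : ℕ → Rn n} (hx0 : x 0 ∈ C)
    (hz : ∀ k, IsProj C (x k - γ k • B (x k)) (z k))
    (hx : ∀ k, IsProj C (z k - γ k • (B (z k) - B (x k))) (x (k + 1)))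
    {σ β θ : ℝ} (hσ : 0 < σ) (hβ : β ∈ Set.Ioo (0 : ℝ) 1) (hθ : θ ∈ Set.Ioo (0 : ℝ) 1)
    (harm : ArmijoGoldstein B (indicatorFun C) σ β θ x γ) :
    ∃ s ∈ C, (∀ y ∈ C, 0 ≤ inner ℝ (B s) (y - s)) ∧ Tendsto x atTop (𝓝 s) := by
  have hne : C.Nonempty := ⟨_, hx0⟩
  have hxC : ∀ k, x k ∈ C := fun k => by
    cases k with
    | zero => exact hx0
    | succ k => exact (hx k).1
  have hz' := fun k => (hz k).inner_le_zero hC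
  have hx' := fun k => (hx k).inner_le_zero hC
  choose i hi hγi using harm
  have hγ : ∀ k, 0 < γ k := fun k => by
    rw [hγi]
    exact mul_pos hσ (pow_pos hβ.1 _)
  have htest : ∀ k, γ k * ‖B (z k) - B (x k)‖ ≤ θ * ‖z k - x k‖ := by
    intro k
    obtain ⟨δ, hδ, q, hq, hle⟩ := (hi k).1
    rw [← hγi k] at hδ
    subst hδ
    obtain ⟨hqC, hq'⟩ := (isProx_smul_indicatorFun_iff (hγ k) hne).1 hq
    -- The point in the test is existentially quantified; uniqueness identifies it with `z k`.
    rwa [projection_unique hqC (hz k).1 hq' (hz' k)] at hle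
  have hθ2 : 0 < 1 - θ ^ 2 := by nlinarith [hθ.1, hθ.2]
  have hstep : ∀ s ∈ C, (∀ y ∈ C, 0 ≤ inner ℝ (B s) (y - s)) → ∀ k,
      ‖x (k + 1) - s‖ ^ 2 ≤ ‖x k - s‖ ^ 2 - (1 - θ ^ 2) * ‖z k - x k‖ ^ 2 := fun s hs hvi k =>
    fbf_step_le hB (hγ k) hs hvi (hz k).1 (hz' k) (hx' k) (htest k)
  have hanti : ∀ s ∈ C, (∀ y ∈ C, 0 ≤ inner ℝ (B s) (y - s)) →
      Antitone fun k => ‖x k - s‖ := fun s hs hvi =>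
    antitone_nat_of_succ_le fun k => by
      refine le_of_sq_le_sq ((hstep s hs hvi k).trans ?_) (norm_nonneg _)
      exact sub_le_self _ (by positivity)
  obtain ⟨s, hs, hvi⟩ := hsol
  have hzx : Tendsto (fun k => ‖x k - z k‖) atTop (𝓝 0) := by
    have h1 := tendsto_zero_of_le_sub (a := fun k => ‖x k - s‖ ^ 2)
      (fun k => by positivity) (fun k => by positivity) (hstep s hs hvi)
    have h2 := (h1.const_mul (1 - θ ^ 2)⁻¹).sqrt
    simpa [inv_mul_cancel_left₀ hθ2.ne', Real.sqrt_sq, norm_sub_rev] using h2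
  choose w hwC e hnormal hxw he using fun k =>
    exists_normal_of_isLeast hne hcl hC hσ hβ hθ.1 (hi k) (hz k).1 (hγi k ▸ hz' k)
  have hmem : ∀ k, x k ∈ Metric.closedBall s ‖x 0 - s‖ := fun k => by
    rw [mem_closedBall_iff_norm]
    exact hanti s hs hvi (Nat.zero_le k)
  obtain ⟨t, -, φ, hφ, hlim⟩ := tendsto_subseq_of_bounded Metric.isBounded_closedBall hmem
  have htC : t ∈ C := hcl.mem_of_tendsto hlim (Eventually.of_forall fun k => hxC _)
  have hwlim : Tendsto (w ∘ φ) atTop (𝓝 t) := by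
    have h1 : Tendsto (fun k => x k - w k) atTop (𝓝 0) :=
      squeeze_zero_norm hxw (by simpa using hzx.div_const β)
    simpa [Function.comp_def] using hlim.sub (h1.comp hφ.tendsto_atTop)
  have hBlim : ∀ v : ℕ → Rn n, (∀ k, v k ∈ C) → Tendsto v atTop (𝓝 t) →
      Tendsto (fun k => B (v k)) atTop (𝓝 (B t)) := fun v hv hvt =>
    (hBc t htC).tendsto.comp (tendsto_nhdsWithin_iff.2 ⟨hvt, Eventually.of_forall hv⟩)
  have hBx := hBlim _ (fun k => hxC (φ k)) hlim
  have hBw := hBlim _ (fun k => hwC (φ k)) hwlim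
  have helim : Tendsto (e ∘ φ) atTop (𝓝 0) := by
    refine squeeze_zero_norm (fun k => he (φ k)) ?_
    simpa using ((hzx.comp hφ.tendsto_atTop).div_const σ).add ((hBw.sub hBx).norm.div_const θ)
  have hvit : ∀ y ∈ C, 0 ≤ inner ℝ (B t) (y - t) := by
    intro y hy
    have h1 := (helim.sub hBx).inner (𝕜 := ℝ) (hwlim.const_sub y)
    have h2 := le_of_tendsto' h1 (fun k => hnormal (φ k) y hy)
    rw [zero_sub, inner_neg_left] at h2
    linarith
  refine ⟨t, htC, hvit, tendsto_iff_norm_sub_tendsto_zero.2 ?_⟩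
  -- Since `t` is itself a solution, `‖x k - t‖` is antitone, so its limit is decided along `φ`.
  exact (tendsto_iff_tendsto_subseq_of_antitone (hanti t htC hvit) hφ.tendsto_atTop).2
    (tendsto_iff_norm_sub_tendsto_zero.1 hlim)

end Iteration

end TsengFBF

theorem proposition2 (n : ℕ)
    (C : Set (TsengFBF.Rn n)) (hC_closed : IsClosed C) (hC_convex : Convex ℝ C)
    (hC_int : (interior C).Nonempty)
    (h : TsengFBF.Rn n → EReal) (h_proper : TsengFBF.IsProperFunction h)
    (h_lsc : LowerSemicontinuous h) (h_convex : TsengFBF.IsConvexFunction h)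
    (hC_dom : C ⊆ interior (TsengFBF.effectiveDomain h))
    (h_diff : TsengFBF.IsContDiffOn h C)
    (A : TsengFBF.Rn n → TsengFBF.Rn n)
    (hA_mono : TsengFBF.IsMonotoneOperator (TsengFBF.operatorOn C A))
    (hA_cont : ContinuousOn A C)
    (h_sol : ∃ x : TsengFBF.Rn n, TsengFBF.IsSolution C h A x)
    (γ : ℕ → ℝ) (x z : ℕ → TsengFBF.Rn n)
    (h_alg : TsengFBF.IsFBFSequence C h A γ x z)
    (σ β θ : ℝ) (hσ : 0 < σ) (hβ : β ∈ Set.Ioo (0 : ℝ) 1) (hθ : θ ∈ Set.Ioo (0 : ℝ) 1)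
    (h_armijo : TsengFBF.ArmijoGoldstein (fun y => A y + TsengFBF.grad h y)
      (TsengFBF.indicatorFun C) σ β θ x γ) :
    ∃ xhat : TsengFBF.Rn n, TsengFBF.IsSolution C h A xhat ∧
      xhat ∈ TsengFBF.operatorDomain (TsengFBF.operatorOn C A) ∧
      Filter.Tendsto x Filter.atTop (nhds xhat) := by
  have hdom : ∀ y ∈ C, y ∈ TsengFBF.effectiveDomain h := fun y hy => interior_subset (hC_dom hy)
  have hiff := fun y => TsengFBF.isSolution_iff (A := A) (x := y) h_proper h_convex hC_dom h_diff.1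
  obtain ⟨s, hs⟩ := h_sol
  obtain ⟨t, ht, hvi, hlim⟩ := TsengFBF.fbf_tendsto hC_closed hC_convex
    (B := fun y => A y + TsengFBF.grad h y)
    (fun u hu v hv => by
      have h1 := hA_mono u v (A u) ⟨hu, rfl⟩ (A v) ⟨hv, rfl⟩
      have h2 := TsengFBF.grad_monotone h_proper h_convex (hdom u hu) (hdom v hv)
        (h_diff.1 u hu) (h_diff.1 v hv)
      rw [add_sub_add_comm, inner_add_left]
      exact add_nonneg h1 h2)
    (hA_cont.add h_diff.2) ⟨s, (hiff s).1 hs⟩ h_alg.init_mem h_alg.forward_backward h_alg.forward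
    hσ hβ hθ h_armijo
  exact ⟨t, (hiff t).2 ⟨ht, hvi⟩, ⟨A t, ht, rfl⟩, hlim⟩
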